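/- **Setting.** A qubit state is a positive semidefinite $2\times2$ complex matrix of trace $1$. For states put $F(\rho,\sigma)=\|\sqrt\rho\sqrt\sigma\|_1$, where $\|A\|_1=\operatorname{tr}\sqrt{A^\dagger A}$ (square-root Uhlmann fidelity). Let $\mathcal D_1,\mathcal D_2$ be compact sets of qubit states, finite or infinite, and $F_{\max}=\sup_{\rho_1\in\mathcal D_1,\rho_2\in\mathcal D_2}F(\rho_1,\rho_2)$. For $p\in(0,1)$ and $n\ge1$ let $$P_{e,\min}(n)=\inf_{0\le\Pi\le I}\ \sup_{\rho_1\in\mathcal D_1,\,\rho_2\in\mathcal D_2}\Bigl(p\operatorname{tr}\bigl((I-\Pi)\rho_1^{\otimes n}\bigr)+(1-p)\operatorname{tr}\bigl(\Pi\rho_2^{\otimes n}\bigr)\Bigr),$$ the infimum being over operators $\Pi$ on $(\mathbb C^2)^{\otimes n}$. For $\delta\in(0,1)$ let $n^*(\delta)=\inf\{n\ge1: P_{e,\min}(n)\le\delta\}$ be the sample complexity. **Theorem.** Let $p\in(0,1)$. Consider all pairs of compact sets $\mathcal D_1,\mathcal D_2$ of qubit states with $F_{\max}\le\frac25$ that are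 not orthogonal (there are $\rho_1\in\mathcal D_1$, $\rho_2\in\mathcal D_2$ with $\rho_1\rho_2\ne0$), and all $\delta$ with $0<\delta<\min\{p,1-p\}$. 1. $n^*(\delta)$ is finite, the infimum below is a finite real number, and $$n^*(\delta)\le\left\lceil\inf_{a\in(0,\ln(5/2))}\frac{\ln\frac{\sqrt{p(1-p)}}{\delta}+\ln\frac{9e^{3(a-1)}}{2a^3}}{-\ln F_{\max}-a}\right\rceil .$$ 2. $n^*(\delta)=\Theta\bigl(\frac{\ln(1/\delta)}{-\ln F_{\max}}\bigr)$ for fixed $p$, in the following sense. There are constants $c,C>0$ depending only on $p$ such that, for all such $\mathcal D_1,\mathcal D_2,\delta$, $$c\,\frac{\ln(1/\delta)}{-\ln F_{\max}}\le n^*(\delta)\le C\max\Bigl\{1,\frac{\ln(1/\delta)}{-\ln F_{\max}}\Bigr\},$$ and moreover $n^*(\delta)\le C\,\frac{\ln(1/\delta)}{-\ln F_{\max}}$ whenever $\delta\le F_{\max}$. -/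

import Mathlib

open scoped MatrixOrder ComplexOrder

noncomputable section

namespace CompositeQHT

/-- Density matrices on a finite-dimensional Hilbert space with orthonormal basis `ι`. -/
def IsState {ι : Type*} [Fintype ι] (ρ : Matrix ι ι ℂ) : Prop :=
  ρ.PosSemidef ∧ ρ.trace = 1

/-- The trace norm `‖A‖₁ = tr √(A† A)`. -/
def traceNorm {ι : Type*} [Fintype ι] [DecidableEq ι] (A : Matrix ι ι ℂ) : ℝ :=
  (CFC.sqrt (A.conjTranspose * A)).trace.re

/-- The (square root) Uhlmann fidelity `F(ρ, σ) = ‖√ρ √σ‖₁`. -/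
def fidelity {ι : Type*} [Fintype ι] [DecidableEq ι] (ρ σ : Matrix ι ι ℂ) : ℝ :=
  traceNorm (CFC.sqrt ρ * CFC.sqrt σ)

/-- The tensor power `ρ^{⊗ n}`, written in the product basis of `(ℂ^d)^{⊗ n}`, which is indexed
by the words of length `n` over the basis of `ℂ^d`. -/
def tensorPow {d : ℕ} (ρ : Matrix (Fin d) (Fin d) ℂ) (n : ℕ) :
    Matrix (Fin n → Fin d) (Fin n → Fin d) ℂ :=
  Matrix.of fun f g => ∏ i, ρ (f i) (g i)

/-- The operators `Π` with `0 ≤ Π ≤ I`, i.e. the two-outcome measurements `{Π, I - Π}`. -/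
def IsTest {ι : Type*} [Fintype ι] [DecidableEq ι] (T : Matrix ι ι ℂ) : Prop :=
  T.PosSemidef ∧ (1 - T).PosSemidef

/-- The expected error probability `p tr((I - Π) σ₁) + (1 - p) tr(Π σ₂)`. -/
def errorProb {ι : Type*} [Fintype ι] [DecidableEq ι] (T : Matrix ι ι ℂ) (p : ℝ)
    (σ₁ σ₂ : Matrix ι ι ℂ) : ℝ :=
  p * ((1 - T) * σ₁).trace.re + (1 - p) * (T * σ₂).trace.re

/-- The worst-case expected error probability of the test `Π` on `n` copies: the supremum over
`ρ₁ ∈ D₁`, `ρ₂ ∈ D₂` of the error probability on `ρ₁^{⊗ n}`, `ρ₂^{⊗ n}`. -/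
def compositeErrorProb {d : ℕ} (n : ℕ) (T : Matrix (Fin n → Fin d) (Fin n → Fin d) ℂ) (p : ℝ)
    (D₁ D₂ : Set (Matrix (Fin d) (Fin d) ℂ)) : ℝ :=
  sSup {e : ℝ | ∃ ρ₁ ∈ D₁, ∃ ρ₂ ∈ D₂, e = errorProb T p (tensorPow ρ₁ n) (tensorPow ρ₂ n)}

/-- The min-max expected error probability on `n` copies. -/
def minErrorProb {d : ℕ} (n : ℕ) (p : ℝ) (D₁ D₂ : Set (Matrix (Fin d) (Fin d) ℂ)) : ℝ :=
  sInf {e : ℝ | ∃ T : Matrix (Fin n → Fin d) (Fin n → Fin d) ℂ,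
    IsTest T ∧ e = compositeErrorProb n T p D₁ D₂}

/-- The sample complexity `n*(p, D₁, D₂, δ)`: the least number `n ≥ 1` of copies with min-max
expected error probability at most `δ`, and `⊤` if there is none. -/
def sampleComplexity {d : ℕ} (p : ℝ) (D₁ D₂ : Set (Matrix (Fin d) (Fin d) ℂ)) (δ : ℝ) : ℕ∞ :=
  ⨅ (n : ℕ) (_ : 1 ≤ n ∧ minErrorProb n p D₁ D₂ ≤ δ), (n : ℕ∞)

/-- The maximal fidelity `F_max` between states of `D₁` and states of `D₂`. -/
def maxFidelity {d : ℕ} (D₁ D₂ : Set (Matrix (Fin d) (Fin d) ℂ)) : ℝ :=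
  sSup {f : ℝ | ∃ ρ₁ ∈ D₁, ∃ ρ₂ ∈ D₂, f = fidelity ρ₁ ρ₂}

/-- Pairs of compact sets of qubit states that are not orthogonal to each other (in particular
both are nonempty) and that satisfy the max-fidelity constraint `F_max ≤ 2/5`. -/
structure IsConstrainedPair (D₁ D₂ : Set (Matrix (Fin 2) (Fin 2) ℂ)) : Prop where
  isCompact_left : IsCompact D₁
  isCompact_right : IsCompact D₂
  isState_left : ∀ ρ ∈ D₁, IsState ρ
  isState_right : ∀ ρ ∈ D₂, IsState ρ
  not_orthogonal : ∃ ρ₁ ∈ D₁, ∃ ρ₂ ∈ D₂, ρ₁ * ρ₂ ≠ 0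
  maxFidelity_le : maxFidelity D₁ D₂ ≤ 2 / 5

end CompositeQHT

end

/-!
The set of tests is convex and compact and the error probability is affine in the test and in each
state, so Sion's minimax theorem replaces the composite problem on `n` copies by the worst
discrimination problem between a mixture of the powers `ρ₁^{⊗ n}` and a mixture of the powers
`ρ₂^{⊗ n}`. These powers lie in the space of permutation-symmetric matrices, whose dimension
is polynomial in `n`; by Carathéodory each mixture needs only polynomially many terms. The
Powers–Størmer inequality `tr (A + B - |A - B|) ≤ 2 tr (√A √B)` and the
subadditivity of the fidelity over the terms of the mixtures then bound the minimal error by a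
polynomial in `n` times `√(p (1 - p)) F_max ^ n`. The polynomial is absorbed into `K a * exp (a n)`
for every `a > 0`, and the bound on the sample complexity optimizes over `a`. Conversely,
Cauchy–Schwarz on a single pair of states shows that the error is at least
`p (1 - p) F_max ^ (2 n)`.
-/

namespace CompositeQHT

section Matrix

variable {ι : Type*} [Fintype ι]

lemma re_trace_nonneg {A : Matrix ι ι ℂ} (hA : A.PosSemidef) : 0 ≤ A.trace.re :=
  (Complex.nonneg_iff.mp hA.trace_nonneg).1

lemma re_trace_mul_nonneg {A B : Matrix ι ι ℂ} (hA : A.PosSemidef) (hB : B.PosSemidef) :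
    0 ≤ (A * B).trace.re := by
  classical
  obtain ⟨C, rfl⟩ := CStarAlgebra.nonneg_iff_eq_star_mul_self.mp hB.nonneg
  have h := re_trace_nonneg (hA.mul_mul_conjTranspose_same C)
  rwa [Matrix.mul_assoc, Matrix.trace_mul_comm, Matrix.mul_assoc] at h

variable [DecidableEq ι]

lemma posSemidef_sqrt (A : Matrix ι ι ℂ) : (CFC.sqrt A).PosSemidef :=
  Matrix.nonneg_iff_posSemidef.mp (CFC.sqrt_nonneg A)

lemma conjTranspose_sqrt (A : Matrix ι ι ℂ) : (CFC.sqrt A).conjTranspose = CFC.sqrt A :=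
  (posSemidef_sqrt A).isHermitian

lemma sqrt_mul_sqrt {A : Matrix ι ι ℂ} (hA : A.PosSemidef) : CFC.sqrt A * CFC.sqrt A = A :=
  CFC.sqrt_mul_sqrt_self A hA.nonneg

lemma sqrt_smul {c : ℝ} (hc : 0 ≤ c) {A : Matrix ι ι ℂ} (hA : A.PosSemidef) :
    CFC.sqrt (c • A) = √c • CFC.sqrt A := by
  refine CFC.sqrt_unique ?_ ((posSemidef_sqrt A).smul (Real.sqrt_nonneg c)).nonneg
  rw [smul_mul_smul_comm, Real.mul_self_sqrt hc, sqrt_mul_sqrt hA]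

lemma cfc_mul_cfc (A : Matrix ι ι ℂ) (f g : ℝ → ℝ) :
    cfc f A * cfc g A = cfc (fun x => f x * g x) A :=
  (cfc_mul f g A (A.finite_real_spectrum.continuousOn f)
    (A.finite_real_spectrum.continuousOn g)).symm

lemma isTest_cfc (A : Matrix ι ι ℂ) {f : ℝ → ℝ} (hf : ∀ x, f x ∈ Set.Icc 0 1) :
    IsTest (cfc f A) :=
  ⟨Matrix.nonneg_iff_posSemidef.mp (cfc_nonneg fun x _ => (hf x).1),
    Matrix.le_iff.mp (cfc_le_one f A fun x _ => (hf x).2)⟩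

lemma exists_isTest_mul_eq_posPart {A : Matrix ι ι ℂ} (hA : A.IsHermitian) :
    ∃ T, IsTest T ∧ T * A = A⁺ ∧ A * T = A⁺ := by
  have hA' : IsSelfAdjoint A := hA
  set θ : ℝ → ℝ := fun x => if 0 < x then 1 else 0
  have hθ : ∀ x, θ x * x = x⁺ := fun x => by
    by_cases h : 0 < x
    · simp [θ, h, posPart_eq_self.mpr h.le]
    · simp [θ, h, posPart_eq_zero.mpr (not_lt.mp h)]
  have hpos : A⁺ = cfc (fun x : ℝ => x⁺) A := by
    rw [CFC.posPart_def, cfcₙ_eq_cfc]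
  refine ⟨cfc θ A, isTest_cfc A fun x => ?_, ?_, ?_⟩
  · by_cases h : 0 < x <;> simp [θ, h]
  · nth_rw 2 [← cfc_id' ℝ A]
    simp only [cfc_mul_cfc, hθ, hpos]
  · nth_rw 1 [← cfc_id' ℝ A]
    simp only [cfc_mul_cfc, mul_comm _ (θ _), hθ, hpos]

/-- The inequality of Powers and Størmer, in the form due to Audenaert et al. -/
lemma exists_isTest_le_trace_mul {X Y : Matrix ι ι ℂ} (hX : X.PosSemidef) (hY : Y.PosSemidef) :
    ∃ T, IsTest T ∧
      ((1 - T) * (X * X)).trace.re + (T * (Y * Y)).trace.re ≤ (X * Y).trace.re := by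
  have hD : (X - Y).IsHermitian := hX.isHermitian.sub hY.isHermitian
  obtain ⟨T, hT, hTD, hDT⟩ := exists_isTest_mul_eq_posPart hD
  refine ⟨T, hT, ?_⟩
  have hDT' : (X - Y) * (1 - T) = -(X - Y)⁻ := by
    rw [mul_sub, mul_one, hDT, sub_eq_iff_eq_add', ← sub_eq_add_neg,
      CFC.posPart_sub_negPart (X - Y) hD]
  have hleft : ((1 - T) * (X * X)).trace - ((1 - T) * (X * Y)).trace = -((X - Y)⁻ * X).trace := by
    rw [← Matrix.trace_sub, ← mul_sub, ← mul_sub, ← mul_assoc, Matrix.trace_mul_comm, ← mul_assoc,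
      hDT', neg_mul, Matrix.trace_neg]
  have hright : (T * (Y * Y)).trace - (T * (X * Y)).trace = -((X - Y)⁺ * Y).trace := by
    rw [← Matrix.trace_sub, ← mul_sub, ← sub_mul, ← mul_assoc, ← neg_sub X, mul_neg, hTD, neg_mul,
      Matrix.trace_neg]
  have hsplit : (X * Y).trace = ((1 - T) * (X * Y)).trace + (T * (X * Y)).trace := by
    rw [← Matrix.trace_add, ← add_mul, sub_add_cancel, one_mul]
  have hneg := re_trace_mul_nonneg (Matrix.nonneg_iff_posSemidef.mp (CFC.negPart_nonneg (X - Y))) hX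
  have hpos := re_trace_mul_nonneg (Matrix.nonneg_iff_posSemidef.mp (CFC.posPart_nonneg (X - Y))) hY
  replace hleft := congrArg Complex.re hleft
  replace hright := congrArg Complex.re hright
  replace hsplit := congrArg Complex.re hsplit
  simp only [Complex.sub_re, Complex.neg_re, Complex.add_re] at hleft hright hsplit
  linarith

/-- Contractions, written as `C† C ≤ 1` in the Loewner order so that no matrix norm has to be
chosen. -/
def IsContraction (C : Matrix ι ι ℂ) : Prop := C.conjTranspose * C ≤ 1

lemma IsContraction.mul {C D : Matrix ι ι ℂ} (hC : IsContraction C) (hD : IsContraction D) :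
    IsContraction (C * D) :=
  calc (C * D).conjTranspose * (C * D)
      = star D * (C.conjTranspose * C) * D := by
        rw [Matrix.conjTranspose_mul, Matrix.star_eq_conjTranspose]; noncomm_ring
    _ ≤ star D * 1 * D := star_left_conjugate_le_conjugate hC D
    _ ≤ 1 := by rwa [mul_one]

lemma IsContraction.conjTranspose {C : Matrix ι ι ℂ} (hC : IsContraction C) :
    IsContraction C.conjTranspose := by
  -- `1 - C C†` is the sum of `C (1 - C† C) C†` and `(1 - C C†)²`.
  have h := (Matrix.le_iff.mp hC).mul_mul_conjTranspose_same C |>.add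
    (Matrix.posSemidef_conjTranspose_mul_self (1 - C * C.conjTranspose))
  refine Matrix.le_iff.mpr ?_
  convert h using 1
  simp only [Matrix.conjTranspose_sub, Matrix.conjTranspose_mul, Matrix.conjTranspose_one,
    Matrix.conjTranspose_conjTranspose]
  noncomm_ring

lemma exists_pseudoinverse {S : Matrix ι ι ℂ} (hS : S.IsHermitian) :
    ∃ R : Matrix ι ι ℂ, R.IsHermitian ∧ R * S = S * R ∧ S * (R * S) = S ∧
      R * (S * S) * R ≤ 1 := by
  have hS' : IsSelfAdjoint S := hS
  have hid : S = cfc (fun x : ℝ => x) S := (cfc_id' ℝ S).symm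
  have hRS : cfc (fun x : ℝ => x⁻¹) S * S = cfc (fun x : ℝ => x⁻¹ * x) S := by
    nth_rw 2 [hid]
    rw [cfc_mul_cfc]
  have hSR : S * cfc (fun x : ℝ => x⁻¹) S = cfc (fun x : ℝ => x⁻¹ * x) S := by
    nth_rw 1 [hid]
    simp only [cfc_mul_cfc, mul_comm]
  refine ⟨cfc (fun x : ℝ => x⁻¹) S, cfc_predicate _ S, hRS.trans hSR.symm, ?_, ?_⟩
  · rw [hRS]
    nth_rw 1 [hid]
    rw [cfc_mul_cfc]
    simp only [← mul_assoc, mul_inv_mul_cancel, ← hid]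
  · rw [← mul_assoc, mul_assoc, hRS, hSR, cfc_mul_cfc]
    refine cfc_le_one _ S fun x _ => ?_
    by_cases h : x = 0 <;> simp [h]

/-- For a single matrix this is the polar decomposition. -/
lemma exists_isContraction_factor {κ : Type*} [Fintype κ] (X : κ → Matrix ι ι ℂ) :
    ∃ V : κ → Matrix ι ι ℂ, (∀ i, IsContraction (V i)) ∧
      (∀ i, X i = V i * CFC.sqrt (∑ j, (X j).conjTranspose * X j)) ∧
      CFC.sqrt (∑ j, (X j).conjTranspose * X j) = ∑ j, (V j).conjTranspose * X j := by
  set A := ∑ j, (X j).conjTranspose * X j with hA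
  set S := CFC.sqrt A with hSdef
  have hSS : S * S = A := sqrt_mul_sqrt <|
    Matrix.posSemidef_sum _ fun j _ => Matrix.posSemidef_conjTranspose_mul_self (X j)
  obtain ⟨R, hR, hRS, hSRS, hRSSR⟩ := exists_pseudoinverse (posSemidef_sqrt A).isHermitian
  rw [← hSdef] at hRS hSRS hRSSR
  have hconj (B : Matrix ι ι ℂ) (i : κ) :
      (X i * B).conjTranspose * (X i * B) = B.conjTranspose * ((X i).conjTranspose * X i) * B := by
    rw [Matrix.conjTranspose_mul]; noncomm_ring
  have hsum (B : Matrix ι ι ℂ) :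
      ∑ i, (X i * B).conjTranspose * (X i * B) = B.conjTranspose * (S * S) * B := by
    simp only [hconj, ← Finset.sum_mul, ← Finset.mul_sum, hSS, hA]
  have hpos (B : Matrix ι ι ℂ) (i : κ) (_ : i ∈ Finset.univ) :
      0 ≤ (X i * B).conjTranspose * (X i * B) :=
    (Matrix.posSemidef_conjTranspose_mul_self _).nonneg
  refine ⟨fun i => X i * R, fun i => ?_, fun i => ?_, ?_⟩
  · refine (Finset.single_le_sum (hpos R) (Finset.mem_univ i)).trans ?_
    rwa [hsum, hR.eq]
  · have hzero : ∑ i, (X i * (1 - R * S)).conjTranspose * (X i * (1 - R * S)) = 0 := by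
      rw [hsum, mul_assoc, mul_assoc, mul_sub, mul_one, hSRS, sub_self, mul_zero, mul_zero]
    have hi := (Finset.sum_eq_zero_iff_of_nonneg (hpos _)).mp hzero i (Finset.mem_univ i)
    rw [Matrix.conjTranspose_mul_self_eq_zero, mul_sub, mul_one, sub_eq_zero] at hi
    rwa [mul_assoc]
  · simp only [Matrix.conjTranspose_mul, hR.eq, mul_assoc, ← Finset.mul_sum]
    rw [← hA, ← hSS, ← mul_assoc, hRS, mul_assoc, hSRS]

end Matrix

section TraceNorm

variable {ι : Type*} [Fintype ι]

lemma re_trace_mul_conjTranspose_le {M : Matrix ι ι ℂ} (hM : M.PosSemidef) (A B : Matrix ι ι ℂ) :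
    (A * M * B.conjTranspose).trace.re ≤
      √(A * M * A.conjTranspose).trace.re * √(B * M * B.conjTranspose).trace.re := by
  let _ : SeminormedAddCommGroup (Matrix ι ι ℂ) := M.toMatrixSeminormedAddCommGroup hM
  let _ : InnerProductSpace ℂ (Matrix ι ι ℂ) := M.toMatrixInnerProductSpace hM
  have h := re_inner_le_norm (𝕜 := ℂ) B A
  rwa [mul_comm, norm_eq_sqrt_re_inner (𝕜 := ℂ) A, norm_eq_sqrt_re_inner (𝕜 := ℂ) B] at h

variable [DecidableEq ι]

lemma re_trace_mul_le_re_trace {A B : Matrix ι ι ℂ} (hA : A.PosSemidef) (hB : B ≤ 1) :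
    (A * B).trace.re ≤ A.trace.re := by
  have h := re_trace_mul_nonneg hA (Matrix.le_iff.mp hB)
  rw [mul_sub, mul_one, Matrix.trace_sub, Complex.sub_re] at h
  linarith

lemma IsContraction.re_trace_conj_le {C : Matrix ι ι ℂ} (hC : IsContraction C)
    {M A : Matrix ι ι ℂ} (hM : M ≤ 1) (hA : A.PosSemidef) :
    (C * CFC.sqrt A * M * (C * CFC.sqrt A).conjTranspose).trace.re ≤ A.trace.re := by
  have hX := Matrix.posSemidef_conjTranspose_mul_self (C * CFC.sqrt A)
  calc (C * CFC.sqrt A * M * (C * CFC.sqrt A).conjTranspose).trace.re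
      = ((C * CFC.sqrt A).conjTranspose * (C * CFC.sqrt A) * M).trace.re := by
        rw [Matrix.trace_mul_comm, ← mul_assoc]
    _ ≤ ((C * CFC.sqrt A).conjTranspose * (C * CFC.sqrt A)).trace.re :=
        re_trace_mul_le_re_trace hX hM
    _ = (A * (C.conjTranspose * C)).trace.re := by
        rw [Matrix.conjTranspose_mul, conjTranspose_sqrt, mul_assoc, Matrix.trace_mul_comm,
          ← mul_assoc, mul_assoc, sqrt_mul_sqrt hA, Matrix.trace_mul_comm]
    _ ≤ A.trace.re := re_trace_mul_le_re_trace hA hC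

lemma IsContraction.re_trace_mul_le {A C : Matrix ι ι ℂ} (hC : IsContraction C)
    (hA : A.PosSemidef) : (A * C).trace.re ≤ A.trace.re := by
  have h := re_trace_mul_conjTranspose_le hA 1 C.conjTranspose
  simp only [one_mul, Matrix.conjTranspose_one, mul_one, Matrix.conjTranspose_conjTranspose] at h
  have hCC : C * C.conjTranspose ≤ 1 := by
    simpa only [IsContraction, Matrix.conjTranspose_conjTranspose] using hC.conjTranspose
  calc (A * C).trace.re ≤ √A.trace.re * √(C.conjTranspose * A * C).trace.re := h
    _ = √A.trace.re * √(A * (C * C.conjTranspose)).trace.re := by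
        rw [mul_assoc, Matrix.trace_mul_comm, mul_assoc]
    _ ≤ √A.trace.re * √A.trace.re :=
        mul_le_mul_of_nonneg_left (Real.sqrt_le_sqrt (re_trace_mul_le_re_trace hA hCC))
          (Real.sqrt_nonneg _)
    _ = A.trace.re := Real.mul_self_sqrt (re_trace_nonneg hA)

lemma exists_polar_decomposition (M : Matrix ι ι ℂ) : ∃ U, IsContraction U ∧
    M = U * CFC.sqrt (M.conjTranspose * M) ∧
    CFC.sqrt (M.conjTranspose * M) = U.conjTranspose * M := by
  obtain ⟨V, hV, hMV, hsqrt⟩ := exists_isContraction_factor fun _ : Unit => M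
  simp only [Fintype.sum_unique] at hMV hsqrt
  exact ⟨V (), hV (), hMV (), hsqrt⟩

lemma IsContraction.re_trace_mul_le_traceNorm {C : Matrix ι ι ℂ} (hC : IsContraction C)
    (M : Matrix ι ι ℂ) : (M * C).trace.re ≤ traceNorm M := by
  obtain ⟨U, hU, hMU, -⟩ := exists_polar_decomposition M
  conv_lhs => rw [hMU, mul_assoc, Matrix.trace_mul_comm, mul_assoc]
  exact (hC.mul hU).re_trace_mul_le (posSemidef_sqrt _)

lemma exists_traceNorm_eq (M : Matrix ι ι ℂ) :
    ∃ C, IsContraction C ∧ traceNorm M = (M * C).trace.re := by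
  obtain ⟨U, hU, -, hsqrt⟩ := exists_polar_decomposition M
  exact ⟨_, hU.conjTranspose, by rw [traceNorm, hsqrt, Matrix.trace_mul_comm]⟩

lemma traceNorm_smul {c : ℝ} (hc : 0 ≤ c) (M : Matrix ι ι ℂ) :
    traceNorm (c • M) = c * traceNorm M := by
  rw [traceNorm, Matrix.conjTranspose_smul, star_trivial, smul_mul_smul_comm,
    sqrt_smul (mul_self_nonneg c) (Matrix.posSemidef_conjTranspose_mul_self M),
    Real.sqrt_mul_self hc, Matrix.trace_smul, Complex.smul_re, smul_eq_mul, traceNorm]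

end TraceNorm

section Fidelity

variable {ι : Type*} [Fintype ι] [DecidableEq ι] {ρ σ T : Matrix ι ι ℂ} {p : ℝ}

lemma fidelity_nonneg (ρ σ : Matrix ι ι ℂ) : 0 ≤ fidelity ρ σ :=
  re_trace_nonneg (posSemidef_sqrt _)

lemma fidelity_smul_smul (hρ : ρ.PosSemidef) (hσ : σ.PosSemidef) {a b : ℝ} (ha : 0 ≤ a)
    (hb : 0 ≤ b) : fidelity (a • ρ) (b • σ) = √a * √b * fidelity ρ σ := by
  rw [fidelity, sqrt_smul ha hρ, sqrt_smul hb hσ, smul_mul_smul_comm,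
    traceNorm_smul (by positivity), fidelity]

lemma mul_eq_zero_of_fidelity_eq_zero (hρ : ρ.PosSemidef) (hσ : σ.PosSemidef)
    (h : fidelity ρ σ = 0) : ρ * σ = 0 := by
  obtain ⟨M, hM⟩ : ∃ M, M = CFC.sqrt ρ * CFC.sqrt σ := ⟨_, rfl⟩
  have hpos := posSemidef_sqrt (M.conjTranspose * M)
  have habs : CFC.sqrt (M.conjTranspose * M) = 0 := by
    refine hpos.trace_eq_zero_iff.mp <|
      Complex.ext ?_ (Complex.nonneg_iff.mp hpos.trace_nonneg).2.symm
    rwa [hM]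
  have hM0 : M = 0 := by
    rw [← Matrix.conjTranspose_mul_self_eq_zero,
      ← sqrt_mul_sqrt (Matrix.posSemidef_conjTranspose_mul_self M), habs, mul_zero]
  rw [← sqrt_mul_sqrt hρ, ← sqrt_mul_sqrt hσ, mul_assoc, ← mul_assoc (CFC.sqrt ρ) (CFC.sqrt σ),
    ← hM, hM0, zero_mul, mul_zero]

lemma isTest_zero : IsTest (0 : Matrix ι ι ℂ) :=
  ⟨Matrix.PosSemidef.zero, by rw [sub_zero]; exact Matrix.PosSemidef.one⟩

lemma IsTest.one_sub (hT : IsTest T) : IsTest (1 - T) :=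
  ⟨hT.2, by rw [sub_sub_cancel]; exact hT.1⟩

lemma IsTest.fidelity_le (hT : IsTest T) (hρ : ρ.PosSemidef) (hσ : σ.PosSemidef) :
    fidelity ρ σ ≤ √((1 - T) * ρ).trace.re * √σ.trace.re + √ρ.trace.re * √(T * σ).trace.re := by
  obtain ⟨C, hC, hF⟩ := exists_traceNorm_eq (CFC.sqrt ρ * CFC.sqrt σ)
  have hdiag {A M : Matrix ι ι ℂ} (hA : A.PosSemidef) :
      (CFC.sqrt A * M * (CFC.sqrt A).conjTranspose).trace = (M * A).trace := by
    rw [conjTranspose_sqrt, mul_assoc, Matrix.trace_mul_comm, mul_assoc, sqrt_mul_sqrt hA]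
  -- Each half of `√ρ √σ C = √ρ (1 - T) √σ C + √ρ T √σ C` is bounded by Cauchy–Schwarz for the
  -- semi-inner product that the middle factor defines.
  have hleft := re_trace_mul_conjTranspose_le hT.2 (CFC.sqrt ρ) (C.conjTranspose * CFC.sqrt σ)
  have hright := re_trace_mul_conjTranspose_le hT.1 (C * CFC.sqrt ρ) (CFC.sqrt σ)
  have hσC := hC.conjTranspose.re_trace_conj_le (Matrix.le_iff.mpr hT.one_sub.2) hσ
  have hρC := hC.re_trace_conj_le (Matrix.le_iff.mpr hT.2) hρ
  rw [hdiag hρ] at hleft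
  rw [hdiag hσ] at hright
  have hsplit : fidelity ρ σ =
      (CFC.sqrt ρ * (1 - T) * (C.conjTranspose * CFC.sqrt σ).conjTranspose).trace.re +
        (C * CFC.sqrt ρ * T * (CFC.sqrt σ).conjTranspose).trace.re := by
    rw [fidelity, hF, Matrix.conjTranspose_mul, conjTranspose_sqrt,
      Matrix.conjTranspose_conjTranspose, mul_assoc C, mul_assoc C, Matrix.trace_mul_comm C,
      ← Complex.add_re, ← Matrix.trace_add]
    congr 2
    noncomm_ring
  rw [hsplit]
  exact add_le_add (hleft.trans (by gcongr)) (hright.trans (by gcongr))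

lemma IsTest.fidelity_le_of_isState (hT : IsTest T) (hρ : IsState ρ) (hσ : IsState σ) :
    fidelity ρ σ ≤ √((1 - T) * ρ).trace.re + √(T * σ).trace.re := by
  simpa only [hρ.2, hσ.2, Complex.one_re, Real.sqrt_one, mul_one, one_mul]
    using hT.fidelity_le hρ.1 hσ.1

lemma fidelity_le_one (hρ : IsState ρ) (hσ : IsState σ) : fidelity ρ σ ≤ 1 := by
  simpa [hρ.2] using isTest_zero.fidelity_le_of_isState hρ hσ

lemma IsTest.mul_fidelity_sq_le_errorProb (hT : IsTest T) (hp : p ∈ Set.Icc 0 1) (hρ : IsState ρ)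
    (hσ : IsState σ) : p * (1 - p) * fidelity ρ σ ^ 2 ≤ errorProb T p ρ σ := by
  have hα := Real.sq_sqrt (re_trace_mul_nonneg hT.2 hρ.1)
  have hβ := Real.sq_sqrt (re_trace_mul_nonneg hT.1 hσ.1)
  set α := √((1 - T) * ρ).trace.re
  set β := √(T * σ).trace.re
  calc p * (1 - p) * fidelity ρ σ ^ 2 ≤ p * (1 - p) * (α + β) ^ 2 :=
        mul_le_mul_of_nonneg_left (pow_le_pow_left₀ (fidelity_nonneg ρ σ)
          (hT.fidelity_le_of_isState hρ hσ) 2) (mul_nonneg hp.1 (sub_nonneg.mpr hp.2))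
    _ ≤ p * (1 - p) * (α + β) ^ 2 + (p * α - (1 - p) * β) ^ 2 :=
        le_add_of_nonneg_right (sq_nonneg _)
    _ = errorProb T p ρ σ := by rw [errorProb, ← hα, ← hβ]; ring

lemma IsTest.errorProb_nonneg (hT : IsTest T) (hp : p ∈ Set.Icc 0 1) (hρ : ρ.PosSemidef)
    (hσ : σ.PosSemidef) : 0 ≤ errorProb T p ρ σ :=
  add_nonneg (mul_nonneg hp.1 (re_trace_mul_nonneg hT.2 hρ))
    (mul_nonneg (sub_nonneg.mpr hp.2) (re_trace_mul_nonneg hT.1 hσ))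

lemma IsTest.errorProb_le_one (hT : IsTest T) (hp : p ∈ Set.Icc 0 1) (hρ : IsState ρ)
    (hσ : IsState σ) : errorProb T p ρ σ ≤ 1 := by
  have hle {U τ : Matrix ι ι ℂ} (hU : IsTest U) (hτ : IsState τ) : (U * τ).trace.re ≤ 1 := by
    rw [Matrix.trace_mul_comm, ← Complex.one_re, ← hτ.2]
    exact re_trace_mul_le_re_trace hτ.1 (Matrix.le_iff.mpr hU.2)
  calc errorProb T p ρ σ ≤ p * 1 + (1 - p) * 1 :=
        add_le_add (mul_le_mul_of_nonneg_left (hle hT.one_sub hρ) hp.1)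
          (mul_le_mul_of_nonneg_left (hle hT hσ) (sub_nonneg.mpr hp.2))
    _ = 1 := by ring

end Fidelity

section Mixtures

variable {ι κ κ' : Type*} [Fintype ι] [DecidableEq ι] [Fintype κ] [Fintype κ']

lemma re_trace_sqrt_sum_mul_sqrt_sum_le {A : κ → Matrix ι ι ℂ} {B : κ' → Matrix ι ι ℂ}
    (hA : ∀ i, (A i).PosSemidef) (hB : ∀ j, (B j).PosSemidef) :
    (CFC.sqrt (∑ i, A i) * CFC.sqrt (∑ j, B j)).trace.re ≤ ∑ i, ∑ j, fidelity (A i) (B j) := by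
  obtain ⟨V, hV, -, hVA⟩ := exists_isContraction_factor fun i => CFC.sqrt (A i)
  obtain ⟨W, hW, -, hWB⟩ := exists_isContraction_factor fun j => CFC.sqrt (B j)
  simp only [conjTranspose_sqrt, sqrt_mul_sqrt (hA _)] at hVA
  simp only [conjTranspose_sqrt, sqrt_mul_sqrt (hB _)] at hWB
  have hWB' : CFC.sqrt (∑ j, B j) = ∑ j, CFC.sqrt (B j) * W j := by
    rw [← conjTranspose_sqrt, hWB, Matrix.conjTranspose_sum]
    simp only [Matrix.conjTranspose_mul, conjTranspose_sqrt, Matrix.conjTranspose_conjTranspose]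
  rw [hVA, hWB', Finset.sum_mul_sum, Matrix.trace_sum, Complex.re_sum]
  refine Finset.sum_le_sum fun i _ => ?_
  rw [Matrix.trace_sum, Complex.re_sum]
  refine Finset.sum_le_sum fun j _ => ?_
  calc ((V i).conjTranspose * CFC.sqrt (A i) * (CFC.sqrt (B j) * W j)).trace.re
      = (CFC.sqrt (A i) * CFC.sqrt (B j) * (W j * (V i).conjTranspose)).trace.re := by
        rw [mul_assoc, Matrix.trace_mul_comm]
        simp only [mul_assoc]
    _ ≤ fidelity (A i) (B j) := ((hW j).mul (hV i).conjTranspose).re_trace_mul_le_traceNorm _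

lemma exists_isTest_re_trace_add_le {A : κ → Matrix ι ι ℂ} {B : κ' → Matrix ι ι ℂ}
    (hA : ∀ i, (A i).PosSemidef) (hB : ∀ j, (B j).PosSemidef) :
    ∃ T, IsTest T ∧ ((1 - T) * ∑ i, A i).trace.re + (T * ∑ j, B j).trace.re ≤
      ∑ i, ∑ j, fidelity (A i) (B j) := by
  obtain ⟨T, hT, hle⟩ := exists_isTest_le_trace_mul (posSemidef_sqrt (∑ i, A i))
    (posSemidef_sqrt (∑ j, B j))
  rw [sqrt_mul_sqrt (Matrix.posSemidef_sum _ fun i _ => hA i),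
    sqrt_mul_sqrt (Matrix.posSemidef_sum _ fun j _ => hB j)] at hle
  exact ⟨T, hT, hle.trans (re_trace_sqrt_sum_mul_sqrt_sum_le hA hB)⟩

lemma exists_isTest_errorProb_sum_le {p F : ℝ} (hp : p ∈ Set.Icc 0 1) {ρ : κ → Matrix ι ι ℂ}
    {σ : κ' → Matrix ι ι ℂ} (hρ : ∀ i, (ρ i).PosSemidef) (hσ : ∀ j, (σ j).PosSemidef)
    {v : κ → ℝ} {w : κ' → ℝ} (hv : ∀ i, 0 ≤ v i) (hw : ∀ j, 0 ≤ w j)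
    (hF : ∀ i j, fidelity (ρ i) (σ j) ≤ F) :
    ∃ T, IsTest T ∧ errorProb T p (∑ i, v i • ρ i) (∑ j, w j • σ j) ≤
      √(p * (1 - p)) * ((∑ i, √(v i)) * ∑ j, √(w j)) * F := by
  have hq : 0 ≤ 1 - p := sub_nonneg.mpr hp.2
  have hpv i : 0 ≤ p * v i := mul_nonneg hp.1 (hv i)
  have hqw j : 0 ≤ (1 - p) * w j := mul_nonneg hq (hw j)
  obtain ⟨T, hT, hle⟩ := exists_isTest_re_trace_add_le
    (fun i => (hρ i).smul (hpv i)) (fun j => (hσ j).smul (hqw j))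
  simp only [← smul_smul, ← Finset.smul_sum, Matrix.mul_smul, Matrix.trace_smul,
    Complex.smul_re, smul_eq_mul] at hle
  refine ⟨T, hT, hle.trans ?_⟩
  calc ∑ i, ∑ j, fidelity (p • v i • ρ i) ((1 - p) • w j • σ j)
      ≤ ∑ i, ∑ j, √(p * v i) * √((1 - p) * w j) * F := by
        simp only [smul_smul, fidelity_smul_smul (hρ _) (hσ _) (hpv _) (hqw _)]
        gcongr with i _ j _
        exact hF i j
    _ = √(p * (1 - p)) * ((∑ i, √(v i)) * ∑ j, √(w j)) * F := by
        rw [Finset.sum_mul_sum, Real.sqrt_mul hp.1]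
        simp only [Real.sqrt_mul hp.1, Real.sqrt_mul hq, Finset.mul_sum, Finset.sum_mul]
        exact Finset.sum_congr rfl fun i _ => Finset.sum_congr rfl fun j _ => by ring

lemma sum_sqrt_le_sqrt_card {w : κ → ℝ} (hw : ∀ i, 0 ≤ w i) (hw1 : ∑ i, w i = 1) :
    ∑ i, √(w i) ≤ √(Fintype.card κ) := by
  refine Real.le_sqrt_of_sq_le ?_
  simpa only [Real.sq_sqrt (hw _), hw1, mul_one, Finset.card_univ]
    using sq_sum_le_card_mul_sum_sq (s := Finset.univ) (f := fun i => √(w i))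

end Mixtures

section TensorPow

variable {d : ℕ} {ρ σ : Matrix (Fin d) (Fin d) ℂ}

lemma tensorPow_mul (A B : Matrix (Fin d) (Fin d) ℂ) (n : ℕ) :
    tensorPow (A * B) n = tensorPow A n * tensorPow B n := by
  ext f g
  simp only [tensorPow, Matrix.of_apply, Matrix.mul_apply, ← Finset.prod_mul_distrib]
  rw [Finset.prod_univ_sum, Fintype.piFinset_univ]

lemma conjTranspose_tensorPow (A : Matrix (Fin d) (Fin d) ℂ) (n : ℕ) :
    (tensorPow A n).conjTranspose = tensorPow A.conjTranspose n := by
  ext f g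
  simp only [tensorPow, Matrix.conjTranspose_apply, Matrix.of_apply, star_prod]

lemma trace_tensorPow (A : Matrix (Fin d) (Fin d) ℂ) (n : ℕ) :
    (tensorPow A n).trace = A.trace ^ n := by
  simp only [Matrix.trace, Matrix.diag_apply, tensorPow, Matrix.of_apply]
  exact (Fintype.sum_pow (fun j => A j j) n).symm

lemma posSemidef_tensorPow (hρ : ρ.PosSemidef) (n : ℕ) : (tensorPow ρ n).PosSemidef := by
  rw [← sqrt_mul_sqrt hρ, tensorPow_mul]
  nth_rw 1 [← conjTranspose_sqrt]
  rw [← conjTranspose_tensorPow]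
  exact Matrix.posSemidef_conjTranspose_mul_self _

lemma IsState.tensorPow (hρ : IsState ρ) (n : ℕ) : IsState (tensorPow ρ n) :=
  ⟨posSemidef_tensorPow hρ.1 n, by rw [trace_tensorPow, hρ.2, one_pow]⟩

lemma sqrt_tensorPow (hρ : ρ.PosSemidef) (n : ℕ) :
    CFC.sqrt (tensorPow ρ n) = tensorPow (CFC.sqrt ρ) n :=
  CFC.sqrt_unique (by rw [← tensorPow_mul, sqrt_mul_sqrt hρ])
    (posSemidef_tensorPow (posSemidef_sqrt ρ) n).nonneg

lemma traceNorm_tensorPow (A : Matrix (Fin d) (Fin d) ℂ) (n : ℕ) :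
    traceNorm (tensorPow A n) = traceNorm A ^ n := by
  have htrace : (CFC.sqrt (A.conjTranspose * A)).trace = (traceNorm A : ℂ) :=
    Complex.ext rfl (Complex.nonneg_iff.mp (posSemidef_sqrt _).trace_nonneg).2.symm
  rw [traceNorm, conjTranspose_tensorPow, ← tensorPow_mul,
    sqrt_tensorPow (Matrix.posSemidef_conjTranspose_mul_self A), trace_tensorPow, htrace,
    ← Complex.ofReal_pow, Complex.ofReal_re]

lemma fidelity_tensorPow (hρ : ρ.PosSemidef) (hσ : σ.PosSemidef) (n : ℕ) :
    fidelity (tensorPow ρ n) (tensorPow σ n) = fidelity ρ σ ^ n := by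
  rw [fidelity, sqrt_tensorPow hρ, sqrt_tensorPow hσ, ← tensorPow_mul, traceNorm_tensorPow,
    fidelity]

end TensorPow

section Minimax

lemma exists_mem_forall_le_of_forall_exists_le {E F : Type*}
    [TopologicalSpace E] [AddCommGroup E] [IsTopologicalAddGroup E] [Module ℝ E]
    [ContinuousSMul ℝ E] [TopologicalSpace F] [AddCommGroup F] [IsTopologicalAddGroup F]
    [Module ℝ F] [ContinuousSMul ℝ F] {X : Set E} {Y : Set F} {f : E → F → ℝ} {b : ℝ}
    (hX : X.Nonempty) (hXc : IsCompact X) (hXconv : Convex ℝ X) (hYconv : Convex ℝ Y)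
    (hlsc : ∀ y ∈ Y, LowerSemicontinuousOn (fun x => f x y) X)
    (hconvex : ∀ y ∈ Y, QuasiconvexOn ℝ X fun x => f x y)
    (husc : ∀ x ∈ X, UpperSemicontinuousOn (fun y => f x y) Y)
    (hconcave : ∀ x ∈ X, QuasiconcaveOn ℝ Y fun y => f x y)
    (h : ∀ y ∈ Y, ∃ x ∈ X, f x y ≤ b) : ∃ x ∈ X, ∀ y ∈ Y, f x y ≤ b := by
  by_contra! hcon
  obtain ⟨s, hs⟩ :=
    (LowerSemicontinuousOn.inter_biInter_preimage_Iic_eq_empty_iff_exists_finset hXc hlsc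
      (c := b)).mp <| by
      refine Set.eq_empty_of_forall_notMem fun x ⟨hx, hxY⟩ => ?_
      obtain ⟨y, hy, hlt⟩ := hcon x hx
      exact hlt.not_ge (Set.mem_iInter₂.mp hxY y hy)
  obtain ⟨y, hy, hlt⟩ := Sion.exists_lt_iInf_of_lt_iInf_of_finite hX hXc hlsc hconvex hYconv husc
    hconcave hXconv (s.finite_toSet.image Subtype.val) (Subtype.coe_image_subset Y ↑s)
    fun x hx => by
      obtain ⟨y, hy, hlt⟩ := hs x hx
      exact ⟨y, ⟨y, hy, rfl⟩, hlt⟩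
  obtain ⟨x, hx, hle⟩ := h y hy
  exact (hlt x hx).not_ge hle

variable {ι : Type*} [Fintype ι] [DecidableEq ι]

lemma setOf_isTest_eq_Icc : {T : Matrix ι ι ℂ | IsTest T} = Set.Icc 0 1 := by
  ext T
  simp only [IsTest, Set.mem_ofPred_eq, Set.mem_Icc, ← Matrix.nonneg_iff_posSemidef, sub_nonneg]

open scoped Matrix.Norms.L2Operator in
lemma isCompact_setOf_isTest : IsCompact {T : Matrix ι ι ℂ | IsTest T} := by
  have : ProperSpace (Matrix ι ι ℂ) := FiniteDimensional.proper ℂ _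
  rw [setOf_isTest_eq_Icc]
  refine (isCompact_closedBall (0 : Matrix ι ι ℂ) 1).of_isClosed_subset isClosed_Icc fun T hT => ?_
  exact mem_closedBall_zero_iff.mpr ((CStarAlgebra.norm_le_one_iff_of_nonneg T hT.1).mpr hT.2)

lemma convex_setOf_isTest : Convex ℝ {T : Matrix ι ι ℂ | IsTest T} := by
  rw [setOf_isTest_eq_Icc]
  exact convex_Icc 0 1

lemma continuous_errorProb (p : ℝ) :
    Continuous fun x : Matrix ι ι ℂ × Matrix ι ι ℂ × Matrix ι ι ℂ =>
      errorProb x.1 p x.2.1 x.2.2 := by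
  unfold errorProb
  fun_prop

lemma errorProb_combo_left (p : ℝ) (σ₁ σ₂ T U : Matrix ι ι ℂ) {a b : ℝ} (hab : a + b = 1) :
    errorProb (a • T + b • U) p σ₁ σ₂ = a * errorProb T p σ₁ σ₂ + b * errorProb U p σ₁ σ₂ := by
  obtain rfl : b = 1 - a := by linarith
  simp only [errorProb, Matrix.sub_mul, Matrix.add_mul, Matrix.smul_mul, Matrix.trace_sub,
    Matrix.trace_add, Matrix.trace_smul, Complex.sub_re, Complex.add_re, Complex.smul_re,
    smul_eq_mul]
  ring

lemma errorProb_combo_right (p : ℝ) (T σ₁ σ₂ τ₁ τ₂ : Matrix ι ι ℂ) (a b : ℝ) :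
    errorProb T p (a • σ₁ + b • τ₁) (a • σ₂ + b • τ₂) =
      a * errorProb T p σ₁ σ₂ + b * errorProb T p τ₁ τ₂ := by
  simp only [errorProb, Matrix.mul_add, Matrix.mul_smul, Matrix.trace_add, Matrix.trace_smul,
    Complex.add_re, Complex.smul_re, smul_eq_mul]
  ring

lemma exists_isTest_forall_errorProb_le {S₁ S₂ : Set (Matrix ι ι ℂ)} {p b : ℝ}
    (h : ∀ σ₁ ∈ convexHull ℝ S₁, ∀ σ₂ ∈ convexHull ℝ S₂, ∃ T, IsTest T ∧ errorProb T p σ₁ σ₂ ≤ b) :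
    ∃ T, IsTest T ∧ ∀ σ₁ ∈ S₁, ∀ σ₂ ∈ S₂, errorProb T p σ₁ σ₂ ≤ b := by
  set Y := convexHull ℝ S₁ ×ˢ convexHull ℝ S₂
  set f := fun (T : Matrix ι ι ℂ) (σ : Matrix ι ι ℂ × Matrix ι ι ℂ) => errorProb T p σ.1 σ.2
  have hYconv : Convex ℝ Y := (convex_convexHull ℝ S₁).prod (convex_convexHull ℝ S₂)
  have hlsc : ∀ σ ∈ Y, LowerSemicontinuousOn (fun T => f T σ) {T | IsTest T} := fun σ _ =>
    ((continuous_errorProb p).comp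
      (continuous_id.prodMk continuous_const)).lowerSemicontinuous.lowerSemicontinuousOn _
  have hconvex : ∀ σ ∈ Y, QuasiconvexOn ℝ {T | IsTest T} fun T => f T σ := fun σ _ =>
    ConvexOn.quasiconvexOn ⟨convex_setOf_isTest, fun T _ U _ _ _ _ _ hab =>
      (errorProb_combo_left p σ.1 σ.2 T U hab).le⟩
  have husc : ∀ T ∈ {T | IsTest T}, UpperSemicontinuousOn (fun σ => f T σ) Y := fun T _ =>
    ((continuous_errorProb p).comp
      (continuous_const.prodMk continuous_id)).upperSemicontinuous.upperSemicontinuousOn _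
  have hconcave : ∀ T ∈ {T | IsTest T}, QuasiconcaveOn ℝ Y fun σ => f T σ := fun T _ =>
    ConcaveOn.quasiconcaveOn ⟨hYconv, fun σ _ τ _ a b _ _ _ =>
      (errorProb_combo_right p T σ.1 σ.2 τ.1 τ.2 a b).ge⟩
  obtain ⟨T, hT, hle⟩ := exists_mem_forall_le_of_forall_exists_le ⟨0, isTest_zero⟩
    isCompact_setOf_isTest convex_setOf_isTest hYconv hlsc hconvex husc hconcave
    fun σ hσ => h σ.1 hσ.1 σ.2 hσ.2
  exact ⟨T, hT, fun σ₁ h₁ σ₂ h₂ =>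
    hle (σ₁, σ₂) ⟨subset_convexHull ℝ S₁ h₁, subset_convexHull ℝ S₂ h₂⟩⟩

end Minimax

section Caratheodory

lemma linearIndependent_complex_of_isSelfAdjoint {V κ : Type*} [AddCommGroup V] [Module ℂ V]
    [StarAddMonoid V] [StarModule ℂ V] {z : κ → V} (hz : LinearIndependent ℝ z)
    (hsa : ∀ i, IsSelfAdjoint (z i)) : LinearIndependent ℂ z := by
  rw [linearIndependent_iff'] at hz ⊢
  intro s g hg i hi
  refine Complex.ext (hz s (fun i => (g i).re) ?_ i hi) (hz s (fun i => (g i).im) ?_ i hi)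
  · simpa [map_sum, realPart_smul, (hsa _).coe_realPart, (hsa _).imaginaryPart]
      using congrArg (fun v => (realPart v : V)) hg
  · simpa [map_sum, imaginaryPart_smul, (hsa _).coe_realPart, (hsa _).imaginaryPart]
      using congrArg (fun v => (imaginaryPart v : V)) hg

lemma linearIndependent_of_affineIndependent_of_map_eq_one {V κ : Type*} [AddCommGroup V]
    [Module ℝ V] {z : κ → V} (hz : AffineIndependent ℝ z) (φ : V →ₗ[ℝ] ℝ) (hφ : ∀ i, φ (z i) = 1) :
    LinearIndependent ℝ z := by
  rw [affineIndependent_iff] at hz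
  rw [linearIndependent_iff']
  intro s g hg
  refine hz s g ?_ hg
  simpa [hφ] using congrArg φ hg

variable {d n : ℕ}

/-- The joint type of two words: the multiset of the pairs of their letters. -/
def jointType (f g : Fin n → Fin d) : Sym (Fin d × Fin d) n :=
  ⟨Finset.univ.val.map fun i => (f i, g i), by simp⟩

/-- The matrices whose entries depend only on the joint type of the row and column words,
parametrized by the entry at each type. They commute with all permutations of the tensor factors. -/
def ofJointType : (Sym (Fin d × Fin d) n → ℂ) →ₗ[ℂ] Matrix (Fin n → Fin d) (Fin n → Fin d) ℂ where
  toFun φ := Matrix.of fun f g => φ (jointType f g)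
  map_add' _ _ := rfl
  map_smul' _ _ := rfl

lemma tensorPow_mem_range_ofJointType (A : Matrix (Fin d) (Fin d) ℂ) :
    tensorPow A n ∈ LinearMap.range (ofJointType (d := d) (n := n)) := by
  refine ⟨fun m => ((m : Multiset (Fin d × Fin d)).map fun ij => A ij.1 ij.2).prod, ?_⟩
  ext f g
  simp only [ofJointType, jointType, LinearMap.coe_mk, AddHom.coe_mk, Matrix.of_apply, Sym.coe_mk,
    Multiset.map_map, tensorPow]
  rfl

lemma card_le_multichoose_of_linearIndependent_tensorPow {κ : Type*} [Fintype κ]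
    {ρ : κ → Matrix (Fin d) (Fin d) ℂ} (h : LinearIndependent ℂ fun i => tensorPow (ρ i) n) :
    Fintype.card κ ≤ (d ^ 2).multichoose n := by
  let R := LinearMap.range (ofJointType (d := d) (n := n))
  have hR : LinearIndependent ℂ fun i => (⟨_, tensorPow_mem_range_ofJointType (ρ i)⟩ : R) :=
    LinearIndependent.of_comp R.subtype h
  calc Fintype.card κ ≤ Module.finrank ℂ R := hR.fintype_card_le_finrank
    _ ≤ Module.finrank ℂ (Sym (Fin d × Fin d) n → ℂ) := LinearMap.finrank_range_le _
    _ = (d ^ 2).multichoose n := by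
        rw [Module.finrank_fintype_fun_eq_card, Sym.card_sym_eq_multichoose, Fintype.card_prod,
          Fintype.card_fin, sq]

lemma exists_mixture_of_mem_convexHull {D : Set (Matrix (Fin d) (Fin d) ℂ)}
    (hD : ∀ ρ ∈ D, IsState ρ) {σ : Matrix (Fin n → Fin d) (Fin n → Fin d) ℂ}
    (hσ : σ ∈ convexHull ℝ ((tensorPow · n) '' D)) :
    ∃ (κ : Type) (_ : Fintype κ) (ρ : κ → Matrix (Fin d) (Fin d) ℂ) (w : κ → ℝ),
      (∀ i, ρ i ∈ D) ∧ (∀ i, 0 ≤ w i) ∧ ∑ i, w i = 1 ∧ ∑ i, w i • tensorPow (ρ i) n = σ ∧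
      Fintype.card κ ≤ (d ^ 2).multichoose n := by
  obtain ⟨κ, _, z, w, hz, hind, hw, hw1, rfl⟩ := eq_pos_convex_span_of_mem_convexHull hσ
  choose ρ hρD hρz using fun i => hz ⟨i, rfl⟩
  obtain rfl : (fun i => tensorPow (ρ i) n) = z := funext hρz
  have hstate i : IsState (tensorPow (ρ i) n) := (hD _ (hρD i)).tensorPow n
  refine ⟨κ, inferInstance, ρ, w, hρD, fun i => (hw i).le, hw1, rfl, ?_⟩
  refine card_le_multichoose_of_linearIndependent_tensorPow
    (linearIndependent_complex_of_isSelfAdjoint ?_ fun i => (hstate i).1.isHermitian)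
  refine linearIndependent_of_affineIndependent_of_map_eq_one hind
    (Complex.reLm ∘ₗ Matrix.traceLinearMap _ ℝ ℂ) fun i => ?_
  simp only [LinearMap.comp_apply, Matrix.traceLinearMap_apply, (hstate i).2, Complex.reLm_coe,
    Complex.one_re]

end Caratheodory

section CompositeError

variable {d n : ℕ} {p : ℝ} {T : Matrix (Fin n → Fin d) (Fin n → Fin d) ℂ}
  {D₁ D₂ : Set (Matrix (Fin d) (Fin d) ℂ)} {ρ₁ ρ₂ : Matrix (Fin d) (Fin d) ℂ}

lemma compositeErrorProb_nonneg (hp : p ∈ Set.Icc 0 1) (h₁ : ∀ ρ ∈ D₁, IsState ρ)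
    (h₂ : ∀ ρ ∈ D₂, IsState ρ) (hT : IsTest T) : 0 ≤ compositeErrorProb n T p D₁ D₂ := by
  refine Real.sSup_nonneg ?_
  rintro _ ⟨ρ₁, m₁, ρ₂, m₂, rfl⟩
  exact hT.errorProb_nonneg hp (posSemidef_tensorPow (h₁ _ m₁).1 n)
    (posSemidef_tensorPow (h₂ _ m₂).1 n)

lemma errorProb_le_compositeErrorProb (hp : p ∈ Set.Icc 0 1) (h₁ : ∀ ρ ∈ D₁, IsState ρ)
    (h₂ : ∀ ρ ∈ D₂, IsState ρ) (hT : IsTest T) (m₁ : ρ₁ ∈ D₁) (m₂ : ρ₂ ∈ D₂) :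
    errorProb T p (tensorPow ρ₁ n) (tensorPow ρ₂ n) ≤ compositeErrorProb n T p D₁ D₂ := by
  refine le_csSup ⟨1, ?_⟩ ⟨ρ₁, m₁, ρ₂, m₂, rfl⟩
  rintro _ ⟨τ₁, k₁, τ₂, k₂, rfl⟩
  exact hT.errorProb_le_one hp ((h₁ _ k₁).tensorPow n) ((h₂ _ k₂).tensorPow n)

lemma minErrorProb_le_of_forall_errorProb_le (hp : p ∈ Set.Icc 0 1) (h₁ : ∀ ρ ∈ D₁, IsState ρ)
    (h₂ : ∀ ρ ∈ D₂, IsState ρ) (hne₁ : D₁.Nonempty) (hne₂ : D₂.Nonempty) (hT : IsTest T) {b : ℝ}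
    (hb : ∀ ρ₁ ∈ D₁, ∀ ρ₂ ∈ D₂, errorProb T p (tensorPow ρ₁ n) (tensorPow ρ₂ n) ≤ b) :
    minErrorProb n p D₁ D₂ ≤ b := by
  obtain ⟨τ₁, k₁⟩ := hne₁
  obtain ⟨τ₂, k₂⟩ := hne₂
  refine le_trans (csInf_le ⟨0, ?_⟩ ⟨T, hT, rfl⟩) (csSup_le ⟨_, τ₁, k₁, τ₂, k₂, rfl⟩ ?_)
  · rintro _ ⟨U, hU, rfl⟩
    exact compositeErrorProb_nonneg hp h₁ h₂ hU
  · rintro _ ⟨ρ₁, m₁, ρ₂, m₂, rfl⟩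
    exact hb ρ₁ m₁ ρ₂ m₂

lemma bddAbove_fidelity (h₁ : ∀ ρ ∈ D₁, IsState ρ) (h₂ : ∀ ρ ∈ D₂, IsState ρ) :
    BddAbove {x : ℝ | ∃ ρ₁ ∈ D₁, ∃ ρ₂ ∈ D₂, x = fidelity ρ₁ ρ₂} := by
  refine ⟨1, ?_⟩
  rintro _ ⟨ρ₁, m₁, ρ₂, m₂, rfl⟩
  exact fidelity_le_one (h₁ _ m₁) (h₂ _ m₂)

lemma fidelity_le_maxFidelity (h₁ : ∀ ρ ∈ D₁, IsState ρ) (h₂ : ∀ ρ ∈ D₂, IsState ρ)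
    (m₁ : ρ₁ ∈ D₁) (m₂ : ρ₂ ∈ D₂) : fidelity ρ₁ ρ₂ ≤ maxFidelity D₁ D₂ :=
  le_csSup (bddAbove_fidelity h₁ h₂) ⟨ρ₁, m₁, ρ₂, m₂, rfl⟩

lemma mul_fidelity_pow_sq_le_minErrorProb (hp : p ∈ Set.Icc 0 1) (h₁ : ∀ ρ ∈ D₁, IsState ρ)
    (h₂ : ∀ ρ ∈ D₂, IsState ρ) (m₁ : ρ₁ ∈ D₁) (m₂ : ρ₂ ∈ D₂) (n : ℕ) :
    p * (1 - p) * (fidelity ρ₁ ρ₂ ^ n) ^ 2 ≤ minErrorProb n p D₁ D₂ := by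
  refine le_csInf ⟨_, 0, isTest_zero, rfl⟩ ?_
  rintro _ ⟨T, hT, rfl⟩
  calc p * (1 - p) * (fidelity ρ₁ ρ₂ ^ n) ^ 2
      = p * (1 - p) * fidelity (tensorPow ρ₁ n) (tensorPow ρ₂ n) ^ 2 := by
        rw [fidelity_tensorPow (h₁ _ m₁).1 (h₂ _ m₂).1]
    _ ≤ errorProb T p (tensorPow ρ₁ n) (tensorPow ρ₂ n) :=
        hT.mul_fidelity_sq_le_errorProb hp ((h₁ _ m₁).tensorPow n) ((h₂ _ m₂).tensorPow n)
    _ ≤ compositeErrorProb n T p D₁ D₂ := errorProb_le_compositeErrorProb hp h₁ h₂ hT m₁ m₂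

lemma mul_maxFidelity_pow_sq_le_minErrorProb (hp : p ∈ Set.Icc 0 1) (h₁ : ∀ ρ ∈ D₁, IsState ρ)
    (h₂ : ∀ ρ ∈ D₂, IsState ρ) (hne₁ : D₁.Nonempty) (hne₂ : D₂.Nonempty) (n : ℕ) :
    p * (1 - p) * (maxFidelity D₁ D₂ ^ n) ^ 2 ≤ minErrorProb n p D₁ D₂ := by
  obtain ⟨τ₁, k₁⟩ := hne₁
  obtain ⟨τ₂, k₂⟩ := hne₂
  have hclosed : IsClosed {x : ℝ | p * (1 - p) * (x ^ n) ^ 2 ≤ minErrorProb n p D₁ D₂} :=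
    isClosed_le (by fun_prop) continuous_const
  refine closure_minimal ?_ hclosed
    (csSup_mem_closure ⟨_, τ₁, k₁, τ₂, k₂, rfl⟩ (bddAbove_fidelity h₁ h₂))
  rintro _ ⟨ρ₁, m₁, ρ₂, m₂, rfl⟩
  exact mul_fidelity_pow_sq_le_minErrorProb hp h₁ h₂ m₁ m₂ n

lemma exists_isTest_errorProb_le_of_mem_convexHull (hp : p ∈ Set.Icc 0 1)
    (h₁ : ∀ ρ ∈ D₁, IsState ρ) (h₂ : ∀ ρ ∈ D₂, IsState ρ)
    {σ₁ σ₂ : Matrix (Fin n → Fin d) (Fin n → Fin d) ℂ}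
    (hσ₁ : σ₁ ∈ convexHull ℝ ((tensorPow · n) '' D₁))
    (hσ₂ : σ₂ ∈ convexHull ℝ ((tensorPow · n) '' D₂)) :
    ∃ T, IsTest T ∧ errorProb T p σ₁ σ₂ ≤
      √(p * (1 - p)) * (d ^ 2).multichoose n * maxFidelity D₁ D₂ ^ n := by
  obtain ⟨κ₁, _, ρ, v, hρ, hv, hv1, rfl, hκ₁⟩ := exists_mixture_of_mem_convexHull h₁ hσ₁
  obtain ⟨κ₂, _, τ, w, hτ, hw, hw1, rfl, hκ₂⟩ := exists_mixture_of_mem_convexHull h₂ hσ₂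
  have hF i j : fidelity (tensorPow (ρ i) n) (tensorPow (τ j) n) ≤ maxFidelity D₁ D₂ ^ n := by
    rw [fidelity_tensorPow (h₁ _ (hρ i)).1 (h₂ _ (hτ j)).1]
    exact pow_le_pow_left₀ (fidelity_nonneg _ _)
      (fidelity_le_maxFidelity h₁ h₂ (hρ i) (hτ j)) n
  have hF₀ : 0 ≤ maxFidelity D₁ D₂ := Real.sSup_nonneg <| by
    rintro _ ⟨_, _, _, _, rfl⟩
    exact fidelity_nonneg _ _
  obtain ⟨T, hT, hle⟩ := exists_isTest_errorProb_sum_le hp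
    (fun i => posSemidef_tensorPow (h₁ _ (hρ i)).1 n)
    (fun j => posSemidef_tensorPow (h₂ _ (hτ j)).1 n) hv hw hF
  have hsum : (∑ i, √(v i)) * ∑ j, √(w j) ≤ (d ^ 2).multichoose n :=
    calc (∑ i, √(v i)) * ∑ j, √(w j)
        ≤ √((d ^ 2).multichoose n) * √((d ^ 2).multichoose n) := by
          gcongr
          · exact (sum_sqrt_le_sqrt_card hv hv1).trans (by gcongr)
          · exact (sum_sqrt_le_sqrt_card hw hw1).trans (by gcongr)
      _ = (d ^ 2).multichoose n := Real.mul_self_sqrt (Nat.cast_nonneg _)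
  exact ⟨T, hT, hle.trans (by gcongr)⟩

lemma minErrorProb_le (hp : p ∈ Set.Icc 0 1) (h₁ : ∀ ρ ∈ D₁, IsState ρ)
    (h₂ : ∀ ρ ∈ D₂, IsState ρ) (hne₁ : D₁.Nonempty) (hne₂ : D₂.Nonempty) (n : ℕ) :
    minErrorProb n p D₁ D₂ ≤
      √(p * (1 - p)) * (d ^ 2).multichoose n * maxFidelity D₁ D₂ ^ n := by
  obtain ⟨T, hT, hle⟩ := exists_isTest_forall_errorProb_le fun σ₁ hσ₁ σ₂ hσ₂ =>
    exists_isTest_errorProb_le_of_mem_convexHull (n := n) hp h₁ h₂ hσ₁ hσ₂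
  exact minErrorProb_le_of_forall_errorProb_le hp h₁ h₂ hne₁ hne₂ hT fun ρ₁ m₁ ρ₂ m₂ =>
    hle _ ⟨ρ₁, m₁, rfl⟩ _ ⟨ρ₂, m₂, rfl⟩

end CompositeError

section ComplexityBound

/-- The least constant `K` for which the estimate `x ≤ exp (x - 1)` yields
`(n + k).choose k ≤ K * exp (a * n)` for all `n`. For `k = 3` it is `9 e^{3(a-1)} / (2 a³)`. -/
noncomputable def chooseExpConst (k : ℕ) (a : ℝ) : ℝ :=
  k ^ k * Real.exp (k * (a - 1)) / (k.factorial * a ^ k)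

/-- The number of copies after which a worst-case error of at most
`√(p (1 - p)) * (n + k).choose k * F ^ n` is at most `δ`, when the binomial coefficient is
estimated by an exponential of rate `a`. -/
noncomputable def complexityBound (k : ℕ) (p δ F a : ℝ) : ℝ :=
  (Real.log (√(p * (1 - p)) / δ) + Real.log (chooseExpConst k a)) / (-Real.log F - a)

variable {k : ℕ} {p δ F a l : ℝ}

lemma pow_le_pow_self_mul_exp_sub {y : ℝ} (hy : 0 ≤ y) (k : ℕ) :
    y ^ k ≤ k ^ k * Real.exp (y - k) := by
  obtain rfl | hk := eq_or_ne k 0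
  · simpa using hy
  have hk₀ : (k : ℝ) ≠ 0 := Nat.cast_ne_zero.mpr hk
  calc y ^ k = k ^ k * (y / k) ^ k := by rw [← mul_pow, mul_div_cancel₀ _ hk₀]
    _ ≤ k ^ k * Real.exp (y / k - 1) ^ k := by
        gcongr
        simpa using Real.add_one_le_exp (y / k - 1)
    _ = k ^ k * Real.exp (y - k) := by
        rw [← Real.exp_nat_mul, mul_sub, mul_div_cancel₀ _ hk₀, mul_one]

lemma choose_le_chooseExpConst_mul_exp (ha : 0 < a) (k n : ℕ) :
    ((n + k).choose k : ℝ) ≤ chooseExpConst k a * Real.exp (a * n) :=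
  calc ((n + k).choose k : ℝ) ≤ ((n + k : ℕ) : ℝ) ^ k / k.factorial :=
        Nat.choose_le_pow_div k (n + k)
    _ = (a * (n + k)) ^ k / (k.factorial * a ^ k) := by
        rw [mul_pow, Nat.cast_add]
        field_simp
    _ ≤ k ^ k * Real.exp (a * (n + k) - k) / (k.factorial * a ^ k) := by
        gcongr
        exact pow_le_pow_self_mul_exp_sub (by positivity) k
    _ = chooseExpConst k a * Real.exp (a * n) := by
        rw [chooseExpConst, div_mul_eq_mul_div, mul_assoc, ← Real.exp_add]
        ring_nf

lemma one_le_chooseExpConst (ha : 0 < a) (k : ℕ) : 1 ≤ chooseExpConst k a := by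
  simpa using choose_le_chooseExpConst_mul_exp ha k 0

lemma complexityBound_three :
    complexityBound 3 p δ F = fun a =>
      (Real.log (√(p * (1 - p)) / δ) + Real.log (9 * Real.exp (3 * (a - 1)) / (2 * a ^ 3))) /
        (-Real.log F - a) := by
  have h (a : ℝ) : chooseExpConst 3 a = 9 * Real.exp (3 * (a - 1)) / (2 * a ^ 3) := by
    rw [chooseExpConst, ← mul_div_mul_left _ _ (three_ne_zero (α := ℝ))]
    norm_num [Nat.factorial]
    ring
  ext a
  rw [complexityBound, h]

lemma exists_isGLB_complexityBound (hl : 0 < l) (hlF : l ≤ -Real.log F) (hδ : 0 < δ)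
    (hδp : δ < √(p * (1 - p))) (k : ℕ) :
    ∃ B, 0 < B ∧ IsGLB (complexityBound k p δ F '' Set.Ioo 0 l) B := by
  have hlog : 0 < Real.log (√(p * (1 - p)) / δ) := Real.log_pos ((one_lt_div hδ).mpr hδp)
  have hlower : Real.log (√(p * (1 - p)) / δ) / -Real.log F ∈
      lowerBounds (complexityBound k p δ F '' Set.Ioo 0 l) := by
    rintro _ ⟨a, ha, rfl⟩
    have hK := Real.log_nonneg (one_le_chooseExpConst ha.1 k)
    exact div_le_div₀ (by linarith) (by linarith) (by linarith [ha.2]) (by linarith [ha.1])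
  have hne : (complexityBound k p δ F '' Set.Ioo 0 l).Nonempty := (Set.nonempty_Ioo.mpr hl).image _
  exact ⟨_, (div_pos hlog (hl.trans_le hlF)).trans_le (le_csInf hne hlower),
    isGLB_csInf hne ⟨_, hlower⟩⟩

lemma le_of_isGLB_complexityBound (hl : 0 < l) (hlF : l ≤ -Real.log F) (hδ : 0 < δ)
    (hδp : δ < √(p * (1 - p))) {B : ℝ}
    (hB : IsGLB (complexityBound k p δ F '' Set.Ioo 0 l) B) :
    B ≤ 2 * (Real.log (1 / δ) / -Real.log F) + 2 * Real.log (chooseExpConst k (l / 2)) / l := by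
  have hL : 0 < -Real.log F := hl.trans_le hlF
  have hp : √(p * (1 - p)) ≤ 1 := Real.sqrt_le_one.mpr (by nlinarith [sq_nonneg (2 * p - 1)])
  have hK := Real.log_nonneg (one_le_chooseExpConst (half_pos hl) k)
  have hδ1 : 0 ≤ Real.log (1 / δ) :=
    Real.log_nonneg ((one_le_div hδ).mpr (hδp.le.trans hp))
  have hlog : Real.log (√(p * (1 - p)) / δ) ≤ Real.log (1 / δ) :=
    Real.log_le_log (div_pos (hδ.trans hδp) hδ) (by gcongr)
  calc B ≤ complexityBound k p δ F (l / 2) := hB.1 ⟨l / 2, ⟨half_pos hl, half_lt_self hl⟩, rfl⟩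
    _ ≤ (Real.log (1 / δ) + Real.log (chooseExpConst k (l / 2))) / (-Real.log F / 2) :=
        div_le_div₀ (by positivity) (by linarith) (by positivity) (by linarith)
    _ = 2 * (Real.log (1 / δ) / -Real.log F) +
          2 * Real.log (chooseExpConst k (l / 2)) / -Real.log F := by
        rw [add_div, div_div_eq_mul_div, div_div_eq_mul_div]
        ring
    _ ≤ _ := by gcongr

lemma natCast_le_mul_max_of_isGLB_complexityBound (hl : 0 < l) (hlF : l ≤ -Real.log F)
    (hδ : 0 < δ) (hδp : δ < √(p * (1 - p))) {B : ℝ}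
    (hB : IsGLB (complexityBound k p δ F '' Set.Ioo 0 l) B) {N : ℕ} (hN : (N : ℤ) ≤ ⌈B⌉) :
    (N : ℝ) ≤ (3 + 2 * Real.log (chooseExpConst k (l / 2)) / l) *
      max 1 (Real.log (1 / δ) / -Real.log F) := by
  have hK := Real.log_nonneg (one_le_chooseExpConst (half_pos hl) k)
  set K := Real.log (chooseExpConst k (l / 2))
  set r := Real.log (1 / δ) / -Real.log F
  have hNB : (N : ℝ) ≤ ⌈B⌉ := mod_cast hN
  have hKr : 2 * K / l ≤ 2 * K / l * max 1 r :=
    le_mul_of_one_le_right (by positivity) (le_max_left 1 r)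
  calc (N : ℝ) ≤ B + 1 := hNB.trans (Int.ceil_lt_add_one B).le
    _ ≤ 2 * r + 2 * K / l + 1 := by
        gcongr
        exact le_of_isGLB_complexityBound hl hlF hδ hδp hB
    _ ≤ (3 + 2 * K / l) * max 1 r := by linarith [le_max_left 1 r, le_max_right 1 r]

end ComplexityBound

section SampleComplexity

variable {d : ℕ} {p δ f : ℝ} {D₁ D₂ : Set (Matrix (Fin d) (Fin d) ℂ)}

/-- Pairs of sets of states that are not orthogonal to each other and whose maximal fidelity is at
most `f`: the analogue of `IsConstrainedPair` in dimension `d`. -/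
structure IsSeparatedPair (f : ℝ) (D₁ D₂ : Set (Matrix (Fin d) (Fin d) ℂ)) : Prop where
  isState_left : ∀ ρ ∈ D₁, IsState ρ
  isState_right : ∀ ρ ∈ D₂, IsState ρ
  not_orthogonal : ∃ ρ₁ ∈ D₁, ∃ ρ₂ ∈ D₂, ρ₁ * ρ₂ ≠ 0
  maxFidelity_le : maxFidelity D₁ D₂ ≤ f

lemma IsConstrainedPair.isSeparatedPair {D₁ D₂ : Set (Matrix (Fin 2) (Fin 2) ℂ)}
    (h : IsConstrainedPair D₁ D₂) : IsSeparatedPair (2 / 5) D₁ D₂ :=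
  ⟨h.isState_left, h.isState_right, h.not_orthogonal, h.maxFidelity_le⟩

lemma lt_sqrt_mul_one_sub (hδ : 0 < δ) (hδp : δ < min p (1 - p)) : δ < √(p * (1 - p)) := by
  obtain ⟨h₁, h₂⟩ := lt_min_iff.mp hδp
  exact Real.lt_sqrt_of_sq_lt (sq δ ▸ mul_lt_mul'' h₁ h₂ hδ.le hδ.le)

lemma log_mul_one_sub_nonpos (hp : p ∈ Set.Icc 0 1) : Real.log (p * (1 - p)) ≤ 0 :=
  Real.log_nonpos (mul_nonneg hp.1 (sub_nonneg.mpr hp.2))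
    (mul_le_one₀ hp.2 (sub_nonneg.mpr hp.2) (sub_le_self 1 hp.1))

lemma sampleComplexity_eq_of_isLeast {N : ℕ}
    (hN : IsLeast {n | 1 ≤ n ∧ minErrorProb n p D₁ D₂ ≤ δ} N) :
    sampleComplexity p D₁ D₂ δ = N :=
  le_antisymm (iInf₂_le N hN.1) (le_iInf₂ fun _ hn => Nat.cast_le.mpr (hN.2 hn))

namespace IsSeparatedPair

lemma nonempty_left (h : IsSeparatedPair f D₁ D₂) : D₁.Nonempty :=
  let ⟨ρ₁, m₁, _⟩ := h.not_orthogonal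
  ⟨ρ₁, m₁⟩

lemma nonempty_right (h : IsSeparatedPair f D₁ D₂) : D₂.Nonempty :=
  let ⟨_, _, ρ₂, m₂, _⟩ := h.not_orthogonal
  ⟨ρ₂, m₂⟩

lemma dim_pos (h : IsSeparatedPair f D₁ D₂) : 0 < d := by
  obtain ⟨ρ₁, -, ρ₂, -, hne⟩ := h.not_orthogonal
  refine Nat.pos_of_ne_zero ?_
  rintro rfl
  exact hne (Subsingleton.elim _ _)

lemma maxFidelity_pos (h : IsSeparatedPair f D₁ D₂) : 0 < maxFidelity D₁ D₂ := by
  obtain ⟨ρ₁, m₁, ρ₂, m₂, hne⟩ := h.not_orthogonal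
  have hfid : fidelity ρ₁ ρ₂ ≠ 0 := mt
    (mul_eq_zero_of_fidelity_eq_zero (h.isState_left _ m₁).1 (h.isState_right _ m₂).1) hne
  exact ((fidelity_nonneg ρ₁ ρ₂).lt_of_ne' hfid).trans_le
    (fidelity_le_maxFidelity h.isState_left h.isState_right m₁ m₂)

lemma log_inv_le (h : IsSeparatedPair f D₁ D₂) :
    Real.log f⁻¹ ≤ -Real.log (maxFidelity D₁ D₂) := by
  rw [Real.log_inv]
  exact neg_le_neg (Real.log_le_log h.maxFidelity_pos h.maxFidelity_le)

lemma log_inv_pos (h : IsSeparatedPair f D₁ D₂) (hf : f < 1) : 0 < Real.log f⁻¹ :=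
  Real.log_pos ((one_lt_inv₀ (h.maxFidelity_pos.trans_le h.maxFidelity_le)).mpr hf)

lemma minErrorProb_le_mul_exp (h : IsSeparatedPair f D₁ D₂) (hp : p ∈ Set.Ioo 0 1) (hδ : 0 < δ)
    {a : ℝ} (ha : a ∈ Set.Ioo 0 (Real.log f⁻¹)) (n : ℕ) :
    minErrorProb n p D₁ D₂ ≤ δ * Real.exp
      ((complexityBound (d ^ 2 - 1) p δ (maxFidelity D₁ D₂) a - n) *
        (-Real.log (maxFidelity D₁ D₂) - a)) := by
  have hF := h.maxFidelity_pos
  have hrate : -Real.log (maxFidelity D₁ D₂) - a ≠ 0 := by linarith [h.log_inv_le, ha.2]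
  have hK := zero_lt_one.trans_le (one_le_chooseExpConst ha.1 (d ^ 2 - 1))
  have hs : 0 < √(p * (1 - p)) := Real.sqrt_pos.mpr (mul_pos hp.1 (sub_pos.mpr hp.2))
  have hmult : ((d ^ 2).multichoose n : ℝ) ≤
      chooseExpConst (d ^ 2 - 1) a * Real.exp (a * n) := by
    have hd : d ^ 2 + n - 1 = n + (d ^ 2 - 1) := by have := pow_pos h.dim_pos 2; omega
    rw [Nat.multichoose_eq, hd, Nat.choose_symm_add]
    exact choose_le_chooseExpConst_mul_exp ha.1 _ n
  set F := maxFidelity D₁ D₂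
  calc minErrorProb n p D₁ D₂ ≤ √(p * (1 - p)) * (d ^ 2).multichoose n * F ^ n :=
        minErrorProb_le (Set.Ioo_subset_Icc_self hp) h.isState_left h.isState_right
          h.nonempty_left h.nonempty_right n
    _ ≤ √(p * (1 - p)) * (chooseExpConst (d ^ 2 - 1) a * Real.exp (a * n)) * F ^ n := by gcongr
    _ = δ * Real.exp (Real.log (√(p * (1 - p)) / δ) + Real.log (chooseExpConst (d ^ 2 - 1) a) +
          (a * n + n * Real.log F)) := by
        rw [Real.exp_add, Real.exp_add, Real.exp_add, Real.exp_log (by positivity),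
          Real.exp_log hK, Real.exp_nat_mul, Real.exp_log hF]
        field_simp
    _ = δ * Real.exp ((complexityBound (d ^ 2 - 1) p δ F a - n) * (-Real.log F - a)) := by
        rw [sub_mul, complexityBound, div_mul_cancel₀ _ hrate]
        ring_nf

lemma minErrorProb_le_of_isGLB (h : IsSeparatedPair f D₁ D₂) (hf : f < 1) (hp : p ∈ Set.Ioo 0 1)
    (hδ : 0 < δ) {B : ℝ} (hB : IsGLB (complexityBound (d ^ 2 - 1) p δ (maxFidelity D₁ D₂) ''
      Set.Ioo 0 (Real.log f⁻¹)) B) {n : ℕ} (hn : B ≤ n) :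
    minErrorProb n p D₁ D₂ ≤ δ := by
  -- The infimum need not be attained. But if the error `E` at `n` exceeded `δ`, then every value
  -- of the bound would exceed `n` by at least `log (E / δ) / (-log F)`.
  by_contra! hlt
  have hL := h.log_inv_le
  set E := minErrorProb n p D₁ D₂
  set L := -Real.log (maxFidelity D₁ D₂)
  have hgap : 0 < Real.log (E / δ) := Real.log_pos ((one_lt_div hδ).mpr hlt)
  have hL₀ : 0 < L := (h.log_inv_pos hf).trans_le hL
  have hlower : n + Real.log (E / δ) / L ∈ lowerBounds
      (complexityBound (d ^ 2 - 1) p δ (maxFidelity D₁ D₂) '' Set.Ioo 0 (Real.log f⁻¹)) := by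
    rintro _ ⟨a, ha, rfl⟩
    set g := complexityBound (d ^ 2 - 1) p δ (maxFidelity D₁ D₂) a
    have hE : Real.log (E / δ) ≤ (g - n) * (L - a) := by
      rw [Real.log_le_iff_le_exp (div_pos (hδ.trans hlt) hδ), div_le_iff₀' hδ]
      exact h.minErrorProb_le_mul_exp hp hδ ha n
    have hgn : 0 < g - n := (mul_pos_iff_of_pos_right (by linarith [ha.2])).mp (hgap.trans_le hE)
    rw [← le_sub_iff_add_le', div_le_iff₀ hL₀]
    exact hE.trans (mul_le_mul_of_nonneg_left (by linarith [ha.1]) hgn.le)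
  linarith [hB.2 hlower, div_pos hgap hL₀]

lemma exists_isLeast_le_ceil (h : IsSeparatedPair f D₁ D₂) (hf : f < 1) (hp : p ∈ Set.Ioo 0 1)
    (hδ : 0 < δ) (hδp : δ < √(p * (1 - p))) :
    ∃ N B, IsLeast {n | 1 ≤ n ∧ minErrorProb n p D₁ D₂ ≤ δ} N ∧
      IsGLB (complexityBound (d ^ 2 - 1) p δ (maxFidelity D₁ D₂) ''
        Set.Ioo 0 (Real.log f⁻¹)) B ∧ (N : ℤ) ≤ ⌈B⌉ := by
  obtain ⟨B, hB₀, hB⟩ :=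
    exists_isGLB_complexityBound (h.log_inv_pos hf) h.log_inv_le hδ hδp (d ^ 2 - 1)
  have hmem : ⌈B⌉₊ ∈ {n | 1 ≤ n ∧ minErrorProb n p D₁ D₂ ≤ δ} :=
    ⟨Nat.one_le_ceil_iff.mpr hB₀, h.minErrorProb_le_of_isGLB hf hp hδ hB (Nat.le_ceil B)⟩
  refine ⟨_, B, isLeast_csInf ⟨_, hmem⟩, hB, ?_⟩
  rw [← Int.natCast_ceil_eq_ceil hB₀.le]
  exact_mod_cast Nat.sInf_le hmem

lemma log_inv_div_le_mul (h : IsSeparatedPair f D₁ D₂) (hf : f < 1) (hp : p ∈ Set.Ioo 0 1) {N : ℕ}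
    (hN : 1 ≤ N) (hNδ : minErrorProb N p D₁ D₂ ≤ δ) :
    Real.log (1 / δ) / -Real.log (maxFidelity D₁ D₂) ≤
      (2 + -Real.log (p * (1 - p)) / Real.log f⁻¹) * N := by
  have hF := h.maxFidelity_pos
  have hL := h.log_inv_le
  have hl := h.log_inv_pos hf
  have hpq : 0 < p * (1 - p) := mul_pos hp.1 (sub_pos.mpr hp.2)
  have hm : 0 ≤ -Real.log (p * (1 - p)) :=
    neg_nonneg.mpr (log_mul_one_sub_nonpos (Set.Ioo_subset_Icc_self hp))
  have hlog := Real.log_le_log (by positivity) <|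
    (mul_maxFidelity_pow_sq_le_minErrorProb (Set.Ioo_subset_Icc_self hp) h.isState_left
      h.isState_right h.nonempty_left h.nonempty_right N).trans hNδ
  rw [Real.log_mul hpq.ne' (by positivity), Real.log_pow, Real.log_pow, Nat.cast_two] at hlog
  set L := -Real.log (maxFidelity D₁ D₂)
  set m := -Real.log (p * (1 - p))
  have hNL : Real.log f⁻¹ ≤ N * L :=
    hL.trans (le_mul_of_one_le_left (hl.trans_le hL).le (mod_cast hN))
  rw [div_le_iff₀ (hl.trans_le hL), one_div, Real.log_inv]
  calc -Real.log δ ≤ 2 * (N * L) + m := by linarith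
    _ ≤ 2 * (N * L) + m / Real.log f⁻¹ * (N * L) := by
        rw [div_mul_eq_mul_div]
        gcongr
        exact (le_div_iff₀ hl).mpr (mul_le_mul_of_nonneg_left hNL hm)
    _ = (2 + m / Real.log f⁻¹) * N * L := by ring

end IsSeparatedPair

end SampleComplexity

end CompositeQHT

theorem mainTheorem4_general {d : ℕ} {p f : ℝ} (hp : p ∈ Set.Ioo 0 1) (hf : f ∈ Set.Ioo 0 1) :
    (∀ D₁ D₂ : Set (Matrix (Fin d) (Fin d) ℂ), CompositeQHT.IsSeparatedPair f D₁ D₂ →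
      ∀ δ : ℝ, 0 < δ → δ < √(p * (1 - p)) →
        ∃ N : ℕ, CompositeQHT.sampleComplexity p D₁ D₂ δ = (N : ℕ∞) ∧
          ∃ B : ℝ,
            IsGLB (CompositeQHT.complexityBound (d ^ 2 - 1) p δ (CompositeQHT.maxFidelity D₁ D₂) ''
              Set.Ioo 0 (Real.log f⁻¹)) B ∧
            (N : ℤ) ≤ ⌈B⌉) ∧
    (∃ c : ℝ, 0 < c ∧ ∃ C : ℝ, 0 < C ∧
      ∀ D₁ D₂ : Set (Matrix (Fin d) (Fin d) ℂ), CompositeQHT.IsSeparatedPair f D₁ D₂ →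
        ∀ δ : ℝ, 0 < δ → δ < √(p * (1 - p)) →
          ∃ N : ℕ, CompositeQHT.sampleComplexity p D₁ D₂ δ = (N : ℕ∞) ∧
            c * (Real.log (1 / δ) / (-Real.log (CompositeQHT.maxFidelity D₁ D₂))) ≤ (N : ℝ) ∧
            (N : ℝ) ≤
              C * max 1 (Real.log (1 / δ) / (-Real.log (CompositeQHT.maxFidelity D₁ D₂))) ∧
            (δ ≤ CompositeQHT.maxFidelity D₁ D₂ →
              (N : ℝ) ≤
                C * (Real.log (1 / δ) / (-Real.log (CompositeQHT.maxFidelity D₁ D₂))))) := by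
  have hl : 0 < Real.log f⁻¹ := Real.log_pos ((one_lt_inv₀ hf.1).mpr hf.2)
  have hm : 0 ≤ -Real.log (p * (1 - p)) :=
    neg_nonneg.mpr (CompositeQHT.log_mul_one_sub_nonpos (Set.Ioo_subset_Icc_self hp))
  have hK := Real.log_nonneg (CompositeQHT.one_le_chooseExpConst (half_pos hl) (d ^ 2 - 1))
  refine ⟨fun D₁ D₂ hD δ hδ hδp => ?_, (2 + -Real.log (p * (1 - p)) / Real.log f⁻¹)⁻¹,
    by positivity, 3 + 2 * Real.log (CompositeQHT.chooseExpConst (d ^ 2 - 1) (Real.log f⁻¹ / 2)) /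
      Real.log f⁻¹, by positivity, fun D₁ D₂ hD δ hδ hδp => ?_⟩
  · obtain ⟨N, B, hN, hB, hNB⟩ := hD.exists_isLeast_le_ceil hf.2 hp hδ hδp
    exact ⟨N, CompositeQHT.sampleComplexity_eq_of_isLeast hN, B, hB, hNB⟩
  · obtain ⟨N, B, hN, hB, hNB⟩ := hD.exists_isLeast_le_ceil hf.2 hp hδ hδp
    have hupper := CompositeQHT.natCast_le_mul_max_of_isGLB_complexityBound hl hD.log_inv_le
      hδ hδp hB hNB
    refine ⟨N, CompositeQHT.sampleComplexity_eq_of_isLeast hN, ?_, hupper, fun hδF => ?_⟩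
    · rw [inv_mul_le_iff₀ (by positivity)]
      exact hD.log_inv_div_le_mul hf.2 hp hN.1.1 hN.1.2
    · have hratio : 1 ≤ Real.log (1 / δ) / (-Real.log (CompositeQHT.maxFidelity D₁ D₂)) := by
        rw [one_le_div (hl.trans_le hD.log_inv_le), one_div, Real.log_inv]
        exact neg_le_neg (Real.log_le_log hδ hδF)
      rwa [max_eq_right hratio] at hupper

theorem mainTheorem4 (p : ℝ) (hp0 : 0 < p) (hp1 : p < 1) :
    -- the explicit upper bound on the sample complexity
    (∀ D₁ D₂ : Set (Matrix (Fin 2) (Fin 2) ℂ), CompositeQHT.IsConstrainedPair D₁ D₂ →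
      ∀ δ : ℝ, 0 < δ → δ < min p (1 - p) →
        ∃ N : ℕ, CompositeQHT.sampleComplexity p D₁ D₂ δ = (N : ℕ∞) ∧
          ∃ B : ℝ,
            IsGLB
              ((fun a : ℝ =>
                (Real.log (Real.sqrt (p * (1 - p)) / δ)
                    + Real.log (9 * Real.exp (3 * (a - 1)) / (2 * a ^ 3)))
                  / (-Real.log (CompositeQHT.maxFidelity D₁ D₂) - a)) ''
                Set.Ioo 0 (Real.log (5 / 2))) B ∧
            (N : ℤ) ≤ ⌈B⌉) ∧
    -- the scaling of the sample complexity, with constants that depend on `p` only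
    (∃ c : ℝ, 0 < c ∧ ∃ C : ℝ, 0 < C ∧
      ∀ D₁ D₂ : Set (Matrix (Fin 2) (Fin 2) ℂ), CompositeQHT.IsConstrainedPair D₁ D₂ →
        ∀ δ : ℝ, 0 < δ → δ < min p (1 - p) →
          ∃ N : ℕ, CompositeQHT.sampleComplexity p D₁ D₂ δ = (N : ℕ∞) ∧
            c * (Real.log (1 / δ) / (-Real.log (CompositeQHT.maxFidelity D₁ D₂))) ≤ (N : ℝ) ∧
            (N : ℝ) ≤
              C * max 1 (Real.log (1 / δ) / (-Real.log (CompositeQHT.maxFidelity D₁ D₂))) ∧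
            (δ ≤ CompositeQHT.maxFidelity D₁ D₂ →
              (N : ℝ) ≤
                C * (Real.log (1 / δ) / (-Real.log (CompositeQHT.maxFidelity D₁ D₂))))) := by
  obtain ⟨hbound, c, hc, C, hC, hscaling⟩ :=
    mainTheorem4_general (d := 2) (f := 2 / 5) ⟨hp0, hp1⟩ (by norm_num)
  simp only [Nat.reducePow, Nat.reduceSub, CompositeQHT.complexityBound_three, inv_div] at hbound
  exact ⟨fun D₁ D₂ hD δ hδ hδp =>
      hbound D₁ D₂ hD.isSeparatedPair δ hδ (CompositeQHT.lt_sqrt_mul_one_sub hδ hδp),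
    c, hc, C, hC, fun D₁ D₂ hD δ hδ hδp =>
      hscaling D₁ D₂ hD.isSeparatedPair δ hδ (CompositeQHT.lt_sqrt_mul_one_sub hδ hδp)⟩
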